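/- For a graph $H$ and a graph $G$ let $\mathcal N(H,G)$ be the number of copies of $H$ in $G$ (subgraphs of $G$ isomorphic to $H$), and for a family $\mathcal F$ of graphs let $\mathrm{ex}(n,H,\mathcal F)$ be the maximum of $\mathcal N(H,G)$ over all $n$-vertex graphs $G$ that contain no member of $\mathcal F$ as a (not necessarily induced) subgraph. Let $K_m$, $P_m$ and $I_m$ denote the complete graph, the path and the edgeless graph on $m$ vertices, $M_k$ the matching consisting of $k$ independent edges, $\cup$ disjoint union, $aG$ the disjoint union of $a$ copies of $G$, and $\vee$ the join. **Theorem.** Let $r,p\ge 1$ and $s,a,b\ge 0$ be integers with $s-p+1=a(p-1)+b$ and $0\le b\le p-2$ (so $p\ge 2$), and assume that $r\le p$ or $r\ge 2p$. For $n\ge p+a(2p-1)+2b$ define the $n$-vertex graphs $$G_1=(K_{p-1}\vee I_{n-p+1-a(2p-1)})\cup aK_{2p-1},$$ $$G_2=(K_{p-1}\vee I_{n-p+1-a(2p-1)-(2b+1)})\cup aK_{2p-1}\cup K_{2b+1}.$$ Then there is $n_0=n_0(r,p,s)$ such that for all $n\ge n_0$, $$\mathrm{ex}(n,K_r,\{P_{2p},M_{s+1}\})=\max\{\mathcal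 N(K_r,G_1),\mathcal N(K_r,G_2)\}.$$ -/

import Mathlib

namespace GenTuran

open SimpleGraph

/-- The join `G ∨ H`: the disjoint union of `G` and `H` together with all edges between them. -/
def join {V W : Type} (G : SimpleGraph V) (H : SimpleGraph W) : SimpleGraph (V ⊕ W) where
  Adj
    | .inl v, .inl v' => G.Adj v v'
    | .inr w, .inr w' => H.Adj w w'
    | .inl _, .inr _ => True
    | .inr _, .inl _ => True
  symm := ⟨by
    rintro (v | w) (v' | w') h
    · exact G.adj_symm h
    · trivial
    · trivial
    · exact H.adj_symm h⟩
  loopless := ⟨by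
    rintro (v | w) h
    · exact G.loopless.irrefl v h
    · exact H.loopless.irrefl w h⟩

/-- `k G`: the disjoint union of `k` copies of `G`. -/
def copies (k : ℕ) {V : Type} (G : SimpleGraph V) : SimpleGraph (Fin k × V) where
  Adj x y := x.1 = y.1 ∧ G.Adj x.2 y.2
  symm := ⟨fun _ _ h => ⟨h.1.symm, G.adj_symm h.2⟩⟩
  loopless := ⟨fun x h => G.loopless.irrefl x.2 h.2⟩

/-- The complete graph `K_m`. -/
abbrev K (m : ℕ) : SimpleGraph (Fin m) := ⊤

/-- The graph `I_m` with `m` vertices and no edges. -/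
abbrev I (m : ℕ) : SimpleGraph (Fin m) := ⊥

/-- The path `P_m` on `m` vertices. -/
abbrev P (m : ℕ) : SimpleGraph (Fin m) := pathGraph m

/-- The matching `M_k` consisting of `k` independent edges. -/
abbrev M (k : ℕ) : SimpleGraph (Fin k × Fin 2) := copies k (K 2)

/-- `N(H, G)`: the number of copies of `H` in `G`, that is, of (not necessarily induced) subgraphs
of `G` that are isomorphic to `H`. -/
noncomputable def N {W V : Type} [Fintype V] (H : SimpleGraph W) (G : SimpleGraph V) : ℕ :=
  G.copyCount H

/-- `G` contains no copy (as a not necessarily induced subgraph) of any member of `𝓕`. -/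
def FamilyFree (𝓕 : Set (Σ W : Type, SimpleGraph W)) {V : Type} (G : SimpleGraph V) : Prop :=
  ∀ F ∈ 𝓕, F.2.Free G

open Classical in
/-- The generalized Turán number `ex(n, H, 𝓕)`: the maximum of `N(H, G)` over all `𝓕`-free graphs
`G` on `n` vertices. -/
noncomputable def ex (n : ℕ) {W : Type} (H : SimpleGraph W)
    (𝓕 : Set (Σ W : Type, SimpleGraph W)) : ℕ :=
  (Finset.univ.filter fun G : SimpleGraph (Fin n) => FamilyFree 𝓕 G).sup fun G => N H G

/-- `G₁ = (K_{p-1} ∨ I_{n-p+1-a(2p-1)}) ∪ a K_{2p-1}`; it has `n` vertices as soon as `1 ≤ p` and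
`p - 1 + a(2p-1) ≤ n`. -/
def G₁ (n p a : ℕ) :
    SimpleGraph ((Fin (p - 1) ⊕ Fin (n - (p - 1) - a * (2 * p - 1))) ⊕ (Fin a × Fin (2 * p - 1))) :=
  join (K (p - 1)) (I (n - (p - 1) - a * (2 * p - 1))) ⊕g copies a (K (2 * p - 1))

/-- `G₂ = (K_{p-1} ∨ I_{n-p+1-a(2p-1)-(2b+1)}) ∪ a K_{2p-1} ∪ K_{2b+1}`; it has `n` vertices as soon
as `1 ≤ p` and `p - 1 + a(2p-1) + 2b + 1 ≤ n`. -/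
def G₂ (n p a b : ℕ) :
    SimpleGraph (((Fin (p - 1) ⊕ Fin (n - (p - 1) - a * (2 * p - 1) - (2 * b + 1))) ⊕
      (Fin a × Fin (2 * p - 1))) ⊕ Fin (2 * b + 1)) :=
  (join (K (p - 1)) (I (n - (p - 1) - a * (2 * p - 1) - (2 * b + 1))) ⊕g
    copies a (K (2 * p - 1))) ⊕g K (2 * b + 1)

end GenTuran

namespace GenTuran

open SimpleGraph Finset

/-! ### Counting cliques inside a vertex set -/

/-! Count cliques `K_{r+1}` and put `c = (p-1).choose r`. If `r + 1 ≥ 2p`, a `P_{2p}`-free graph has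
no such clique and both sides vanish. So let `r + 1 ≤ p`, whence `c ≥ 1`.

A maximum matching covers all edges with at most `2s` vertices. For `r ≥ 1`, either boundedly many
vertices outside the cover have degree at least `p-1`, and the count is about `(p-2).choose r * n`,
too small for large `n`; or, by pigeonhole, some `p-1` vertices `S` have at least `p+1` common
neighbours (`exists_star_or_card_cliquesIn_le`). In the second case `P_{2p}`-freeness makes every
outside neighbour of `S` adjacent to `S` only (`mem_of_adj_of_adj_star`), so each costs at most `c`
cliques. The set `R` of remaining vertices is cut off from `S` and has matching number at most
`s-(p-1)`.

Inside `R`, a vertex of degree below `p` can be deleted at a cost of at most `c` cliques. If there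
is none, a longest path closes up to a cycle as in Dirac's theorem, and its `k < 2p` vertices are
joined to nothing else (`exists_closed_chain`). Removing them uses up `k/2` matching edges and gains
at most `k.choose (r+1) - c*k` over the rate of `c` per vertex. This gain, cut off at zero, is
convex in `k`, so it is best to use full parts `K_{2p-1}` and one remainder `K_{2b+1}`
(`splitValue_add_le`). Full parts never lose (`mul_choose_le_choose_succ`); the sign of the gain of
the remainder decides between `G₁` and `G₂`. -/

open Classical in
/-- The `r`-cliques of `G` contained in the vertex set `A`. -/
noncomputable def cliquesIn {V : Type} (G : SimpleGraph V) (r : ℕ) (A : Finset V) :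
    Finset (Finset V) :=
  A.powerset.filter fun s => G.IsNClique r s

theorem mem_cliquesIn {V : Type} {G : SimpleGraph V} {r : ℕ} {A s : Finset V} :
    s ∈ cliquesIn G r A ↔ s ⊆ A ∧ G.IsNClique r s := by
  simp [cliquesIn]

theorem card_cliquesIn_le_choose {V : Type} (G : SimpleGraph V) (r : ℕ) (A : Finset V) :
    #(cliquesIn G r A) ≤ (#A).choose r := by
  rw [← card_powersetCard]
  refine card_le_card fun s hs => ?_
  rw [mem_cliquesIn] at hs
  exact mem_powersetCard.2 ⟨hs.1, hs.2.card_eq⟩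

theorem card_cliquesIn_eq_choose {V : Type} {G : SimpleGraph V} (r : ℕ) {A : Finset V}
    (hA : G.IsClique (A : Set V)) : #(cliquesIn G r A) = (#A).choose r := by
  rw [← card_powersetCard]
  congr 1
  ext s
  rw [mem_cliquesIn, mem_powersetCard, isNClique_iff]
  exact ⟨fun h => ⟨h.1, h.2.2⟩, fun h => ⟨h.1, hA.subset (by exact_mod_cast h.1), h.2⟩⟩

/-- The copies of `K_r` in `G` are the `r`-cliques of `G`. -/
theorem N_K_eq_card_cliquesIn {V : Type} [Fintype V] (G : SimpleGraph V) (r : ℕ) :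
    N (K r) G = #(cliquesIn G r univ) := by
  classical
  unfold N copyCount
  -- A complete subgraph is determined by its vertex set; this makes the map to cliques injective.
  have key : ∀ G' : G.Subgraph, Nonempty (K r ≃g G'.coe) →
      ∀ v ∈ G'.verts, ∀ w ∈ G'.verts, v ≠ w → G'.Adj v w := by
    rintro G' ⟨e⟩ v hv w hw hvw
    have h : (K r).Adj (e.symm ⟨v, hv⟩) (e.symm ⟨w, hw⟩) := by
      rw [top_adj]
      intro h
      exact hvw (by simpa using e.symm.injective h)
    simpa using e.symm.map_rel_iff.1 h
  refine card_bij (fun G' _ => G'.verts.toFinset) ?_ ?_ ?_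
  · intro G' hG'
    simp only [mem_filter, mem_univ, true_and] at hG'
    rw [mem_cliquesIn, isNClique_iff]
    refine ⟨subset_univ _, ?_, ?_⟩
    · intro v hv w hw hvw
      exact G'.adj_sub (key G' hG' v (by simpa using hv) w (by simpa using hw) hvw)
    · obtain ⟨e⟩ := hG'
      rw [Set.toFinset_card, ← Fintype.card_congr e.toEquiv, Fintype.card_fin]
  · intro G' hG' G'' hG'' h
    simp only [mem_filter, mem_univ, true_and] at hG' hG''
    have hv : G'.verts = G''.verts := by simpa using h
    refine Subgraph.ext hv ?_
    ext v w
    constructor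
    · intro hvw
      exact key G'' hG'' v (hv ▸ G'.edge_vert hvw) w (hv ▸ G'.edge_vert hvw.symm) hvw.ne
    · intro hvw
      exact key G' hG' v (hv ▸ G''.edge_vert hvw) w (hv ▸ G''.edge_vert hvw.symm) hvw.ne
  · intro s hs
    rw [mem_cliquesIn, isNClique_iff] at hs
    refine ⟨(⊤ : G.Subgraph).induce s, ?_, by simp⟩
    simp only [mem_filter, mem_univ, true_and]
    let e : Fin r ≃ s := (Fintype.equivFinOfCardEq (by simpa using hs.2.2)).symm
    refine ⟨⟨e.trans (Equiv.setCongr (by simp)), ?_⟩⟩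
    intro i j
    simp only [Subgraph.coe_adj, top_adj, Subgraph.induce_adj, Subgraph.top_adj]
    constructor
    · rintro h rfl
      exact h.2.2.ne rfl
    · intro h
      refine ⟨(e i).2, (e j).2, hs.2.1 (e i).2 (e j).2 ?_⟩
      intro hij
      exact h (e.injective (Subtype.ext hij))

/-- A new clique consists of `v` and `r` of its neighbours in `A`, all of which lie in `D`. -/
theorem card_cliquesIn_insert_le {V : Type} [DecidableEq V] (G : SimpleGraph V) (r : ℕ)
    {A D : Finset V} {v : V} (hD : ∀ w ∈ A, G.Adj v w → w ∈ D) :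
    #(cliquesIn G (r + 1) (insert v A)) ≤ #(cliquesIn G (r + 1) A) + (#D).choose r := by
  classical
  have hsub : cliquesIn G (r + 1) (insert v A) ⊆
      cliquesIn G (r + 1) A ∪ (powersetCard r D).image (insert v) := by
    intro s hs
    rw [mem_cliquesIn] at hs
    rw [mem_union, mem_cliquesIn, mem_image]
    by_cases hv : v ∈ s
    · right
      refine ⟨s.erase v, mem_powersetCard.2 ⟨?_, ?_⟩, insert_erase hv⟩
      · intro w hw
        obtain ⟨hwv, hw⟩ := mem_erase.1 hw
        have hwA : w ∈ A := (mem_insert.1 (hs.1 hw)).resolve_left hwv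
        exact hD w hwA (hs.2.isClique hv hw hwv.symm)
      · rw [card_erase_of_mem hv, hs.2.card_eq, Nat.add_sub_cancel]
    · left
      exact ⟨(subset_insert_iff_of_notMem hv).1 hs.1, hs.2⟩
  calc _ ≤ _ := card_le_card hsub
    _ ≤ _ := card_union_le _ _
    _ ≤ _ := by
      gcongr
      exact card_image_le.trans_eq (card_powersetCard _ _)

theorem card_cliquesIn_union_le_of_degree_le {V : Type} [DecidableEq V] (G : SimpleGraph V)
    (r d : ℕ) (A B : Finset V)
    (h : ∀ v ∈ B, ∃ D : Finset V, #D ≤ d ∧ ∀ w ∈ A ∪ B, G.Adj v w → w ∈ D) :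
    #(cliquesIn G (r + 1) (A ∪ B)) ≤ #(cliquesIn G (r + 1) A) + d.choose r * #B := by
  induction B using Finset.induction_on with
  | empty => simp
  | insert v B hv ih =>
    obtain ⟨D, hD, hDv⟩ := h v (mem_insert_self _ _)
    have h1 := card_cliquesIn_insert_le G r (A := A ∪ B) (D := D) (v := v) fun w hw hvw =>
      hDv w (by rw [union_insert]; exact mem_insert_of_mem hw) hvw
    have h2 := ih fun w hw => by
      obtain ⟨D', h1, h2⟩ := h w (mem_insert_of_mem hw)
      exact ⟨D', h1, fun u hu => h2 u (by rw [union_insert]; exact mem_insert_of_mem hu)⟩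
    have h3 := Nat.choose_le_choose r hD
    rw [union_insert, card_insert_of_notMem hv]
    linarith

theorem card_cliquesIn_union_le {V : Type} [DecidableEq V] (G : SimpleGraph V) (r : ℕ)
    {A B : Finset V} (h : ∀ v ∈ A, ∀ w ∈ B, ¬ G.Adj v w) :
    #(cliquesIn G r (A ∪ B)) ≤ #(cliquesIn G r A) + #(cliquesIn G r B) := by
  classical
  refine (card_le_card ?_).trans (card_union_le _ _)
  intro s hs
  rw [mem_cliquesIn] at hs
  rw [mem_union, mem_cliquesIn, mem_cliquesIn]
  by_contra! hcon
  obtain ⟨x, hx, hxA⟩ := not_subset.1 fun hA => hcon.1 hA hs.2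
  obtain ⟨y, hy, hyB⟩ := not_subset.1 fun hB => hcon.2 hB hs.2
  have hxB : x ∈ B := (mem_union.1 (hs.1 hx)).resolve_left hxA
  have hyA : y ∈ A := (mem_union.1 (hs.1 hy)).resolve_right hyB
  exact h y hyA x hxB (hs.2.isClique hy hx fun hyx => hxA (hyx ▸ hyA))

theorem card_cliquesIn_le_two_pow {V : Type} (G : SimpleGraph V) (r : ℕ) (A : Finset V) :
    #(cliquesIn G r A) ≤ 2 ^ #A :=
  (card_cliquesIn_le_choose G r A).trans (Nat.choose_le_two_pow _ _)

/-! ### Paths and matchings -/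

theorem P_isContained_of_isChain {V : Type} {G : SimpleGraph V} {m : ℕ} {l : List V}
    (hl : l.IsChain G.Adj) (hnd : l.Nodup) (hm : m ≤ l.length) : P m ⊑ G := by
  refine ⟨⟨⟨fun i => l[i.1]'(i.2.trans_le hm), ?_⟩, ?_⟩⟩
  · intro i j hij
    rw [pathGraph_adj] at hij
    rw [List.isChain_iff_getElem] at hl
    rcases hij with h | h
    · have := hl i.1 (by omega)
      simpa only [h] using this
    · have := hl j.1 (by omega)
      simpa only [h] using this.symm
  · intro i j hij
    exact Fin.ext ((hnd.getElem_inj_iff).1 hij)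

/-- `A` is the vertex set of a matching of `G` with `k` edges. -/
inductive MatchedBy {V : Type} [DecidableEq V] (G : SimpleGraph V) : Finset V → ℕ → Prop
  | empty : MatchedBy G ∅ 0
  | insert_edge {x y : V} {A : Finset V} {k : ℕ} : G.Adj x y → x ∉ A → y ∉ A → MatchedBy G A k →
      MatchedBy G (insert x (insert y A)) (k + 1)

theorem MatchedBy.card_eq {V : Type} [DecidableEq V] {G : SimpleGraph V} {A : Finset V} {k : ℕ}
    (h : MatchedBy G A k) : #A = 2 * k := by
  induction h with
  | empty => rfl
  | insert_edge hxy hx hy _ ih =>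
    rw [card_insert_of_notMem (by simp [hxy.ne, hx]), card_insert_of_notMem hy, ih]
    ring

theorem MatchedBy.union {V : Type} [DecidableEq V] {G : SimpleGraph V} {A B : Finset V} {j k : ℕ}
    (hA : MatchedBy G A j) (hB : MatchedBy G B k) (hAB : Disjoint A B) :
    MatchedBy G (A ∪ B) (j + k) := by
  induction hA with
  | empty => simpa using hB
  | @insert_edge x y A j hxy hx hy _ ih =>
    rw [disjoint_insert_left, disjoint_insert_left] at hAB
    rw [insert_union, insert_union, add_right_comm]
    exact (ih hAB.2.2).insert_edge hxy (by simp [hx, hAB.1]) (by simp [hy, hAB.2.1])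

/-- Recording that the copy stays in `A` carries the induction: it keeps the ends of the added edge,
placed at index `0`, off the earlier ones. -/
theorem MatchedBy.exists_copy {V : Type} [DecidableEq V] {G : SimpleGraph V} {A : Finset V} {k : ℕ}
    (h : MatchedBy G A k) : ∃ f : Copy (M k) G, ∀ i, f i ∈ A := by
  induction h with
  | empty => exact ⟨⟨⟨fun i => i.1.elim0, fun {i} => i.1.elim0⟩, fun i => i.1.elim0⟩,
      fun i => i.1.elim0⟩
  | @insert_edge x y A k hxy hx hy _ ih =>
    obtain ⟨f, hf⟩ := ih
    let g : Fin (k + 1) × Fin 2 → V := fun i =>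
      Fin.cases (motive := fun _ => V) (if i.2 = 0 then x else y) (fun j => f (j, i.2)) i.1
    have hfx : ∀ i, f i ≠ x := fun i h => hx (h ▸ hf i)
    have hfy : ∀ i, f i ≠ y := fun i h => hy (h ▸ hf i)
    refine ⟨⟨⟨g, ?_⟩, ?_⟩, ?_⟩
    · rintro ⟨i, i'⟩ ⟨j, j'⟩ ⟨hij, hij'⟩
      obtain rfl : i = j := hij
      replace hij' : i' ≠ j' := hij'
      induction i using Fin.cases with
      | zero => fin_cases i' <;> fin_cases j' <;> simp_all [g, hxy.symm]
      | succ i => exact f.toHom.map_adj (show (M k).Adj (i, i') (i, j') from ⟨rfl, hij'⟩)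
    · rintro ⟨i, i'⟩ ⟨j, j'⟩ hij
      replace hij : g (i, i') = g (j, j') := hij
      induction i using Fin.cases with
      | zero =>
        induction j using Fin.cases with
        | zero =>
          have := hxy.ne
          fin_cases i' <;> fin_cases j' <;> simp_all [g, hxy.ne']
        | succ j =>
          have h1 := hfx (j, j')
          have h2 := hfy (j, j')
          fin_cases i' <;> simp_all [g, eq_comm]
      | succ i =>
        induction j using Fin.cases with
        | zero =>
          have h1 := hfx (i, i')
          have h2 := hfy (i, i')
          fin_cases j' <;> simp_all [g]
        | succ j =>
          have := f.injective (a₁ := (i, i')) (a₂ := (j, j')) hij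
          simp_all
    · rintro ⟨i, i'⟩
      change g (i, i') ∈ _
      induction i using Fin.cases with
      | zero => fin_cases i' <;> simp [g]
      | succ i => exact mem_insert_of_mem (mem_insert_of_mem (hf _))

theorem MatchedBy.exists_of_le {V : Type} [DecidableEq V] {G : SimpleGraph V} {A : Finset V}
    {k : ℕ} (h : MatchedBy G A k) {j : ℕ} (hj : j ≤ k) : ∃ B ⊆ A, MatchedBy G B j := by
  induction h with
  | empty => exact ⟨∅, subset_rfl, by rw [Nat.le_zero.1 hj]; exact .empty⟩
  | insert_edge hxy hx hy h ih =>
    obtain rfl | hj := hj.eq_or_lt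
    · exact ⟨_, subset_rfl, h.insert_edge hxy hx hy⟩
    · obtain ⟨B, hB, hB'⟩ := ih (by omega)
      exact ⟨B, hB.trans ((subset_insert _ _).trans (subset_insert _ _)), hB'⟩

/-- Consecutive vertices of the path are paired off from its start; a last odd vertex stays
unmatched. -/
theorem exists_matchedBy_of_isChain {V : Type} [DecidableEq V] {G : SimpleGraph V} :
    ∀ l : List V, l.IsChain G.Adj → l.Nodup → ∃ B ⊆ l.toFinset, MatchedBy G B (l.length / 2)
  | [], _, _ => ⟨∅, subset_rfl, by simpa using .empty⟩
  | [_], _, _ => ⟨∅, empty_subset _, by simpa using .empty⟩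
  | x :: y :: l, hl, hnd => by
    rw [List.isChain_cons_cons] at hl
    rw [List.nodup_cons, List.nodup_cons] at hnd
    obtain ⟨B, hB, hB'⟩ := exists_matchedBy_of_isChain l hl.2.tail hnd.2.2
    refine ⟨insert x (insert y B), ?_, ?_⟩
    · rw [List.toFinset_cons, List.toFinset_cons]
      gcongr
    · have : (x :: y :: l).length / 2 = l.length / 2 + 1 := by simp; omega
      rw [this]
      refine hB'.insert_edge hl.1 (fun h => ?_) (fun h => ?_)
      · exact hnd.1 (List.mem_cons_of_mem _ (List.mem_toFinset.1 (hB h)))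
      · exact hnd.2.1 (List.mem_toFinset.1 (hB h))

/-! ### Longest paths in graphs of large minimum degree -/

theorem exists_longest_chain {V : Type} [DecidableEq V] (G : SimpleGraph V) (A : Finset V) :
    ∃ l : List V, l.IsChain G.Adj ∧ l.Nodup ∧ (∀ x ∈ l, x ∈ A) ∧
      ∀ l' : List V, l'.IsChain G.Adj → l'.Nodup → (∀ x ∈ l', x ∈ A) → l'.length ≤ l.length := by
  classical
  let Q : ℕ → Prop := fun k =>
    ∃ l : List V, l.IsChain G.Adj ∧ l.Nodup ∧ (∀ x ∈ l, x ∈ A) ∧ l.length = k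
  have hbound : ∀ k, Q k → k ≤ #A := by
    rintro k ⟨l, -, hnd, hlA, rfl⟩
    rw [← List.toFinset_card_of_nodup hnd]
    exact card_le_card fun x hx => hlA x (List.mem_toFinset.1 hx)
  have h0 : Q 0 := ⟨[], by simp, by simp, by simp, rfl⟩
  obtain ⟨l, hl, hnd, hlA, hlen⟩ := Nat.findGreatest_spec (P := Q) (Nat.zero_le (#A)) h0
  refine ⟨l, hl, hnd, hlA, fun l' h1 h2 h3 => ?_⟩
  rw [hlen]
  have hQ : Q l'.length := ⟨l', h1, h2, h3, rfl⟩
  exact Nat.le_findGreatest (hbound _ hQ) hQ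

/-- A cycle is opened at any of its vertices to a path that starts there. -/
theorem exists_chain_of_cycle {V : Type} {G : SimpleGraph V} {c : List V} (hc : c.IsChain G.Adj)
    (hcl : ∀ a ∈ c.getLast?, ∀ b ∈ c.head?, G.Adj a b) {x : V} (hx : x ∈ c) :
    ∃ t : List V, (x :: t).IsChain G.Adj ∧ (x :: t).Perm c := by
  obtain ⟨s, t, rfl⟩ := List.append_of_mem hx
  refine ⟨t ++ s, ?_, ?_⟩
  · rw [List.isChain_append] at hc
    rw [← List.cons_append, List.isChain_append]
    refine ⟨hc.2.1, hc.1, fun a ha b hb => hcl a ?_ b ?_⟩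
    · rw [List.getLast?_append_of_ne_nil _ (by simp)]
      exact ha
    · cases s with
      | nil => simp at hb
      | cons y s => simpa using hb
  · rw [← List.cons_append]
    exact List.perm_append_comm

/-- In a graph of minimum degree at least `p` without a path on `2 * p` vertices, the vertices of a
longest path are not joined to any other vertices. -/
theorem exists_closed_chain {V : Type} [DecidableEq V] {G : SimpleGraph V} [DecidableRel G.Adj]
    {A : Finset V} {p : ℕ} (hA : A.Nonempty)
    (hdeg : ∀ v ∈ A, p ≤ #(A.filter (G.Adj v))) (hfree : (P (2 * p)).Free G) :
    ∃ l : List V, l.IsChain G.Adj ∧ l.Nodup ∧ (∀ x ∈ l, x ∈ A) ∧ l ≠ [] ∧ l.length < 2 * p ∧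
      ∀ x ∈ l, ∀ z ∈ A, z ∉ l → ¬ G.Adj x z := by
  obtain ⟨l, hl, hnd, hlA, hmax⟩ := exists_longest_chain G A
  have hne : l ≠ [] := by
    rintro rfl
    obtain ⟨v, hv⟩ := hA
    simpa using hmax [v] (by simp) (by simp) (by simpa using hv)
  have hlen : l.length < 2 * p := by
    by_contra! h
    exact hfree (P_isContained_of_isChain hl hnd h)
  refine ⟨l, hl, hnd, hlA, hne, hlen, ?_⟩
  have hpos : 0 < l.length := List.length_pos_iff.2 hne
  obtain ⟨u, hu⟩ : ∃ u, l[0] = u := ⟨_, rfl⟩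
  obtain ⟨w, hw⟩ : ∃ w, l[l.length - 1] = w := ⟨_, rfl⟩
  let g : ℕ → V := fun i => l.getD i u
  have hg : ∀ i (hi : i < l.length), l[i] = g i := fun i hi => by simp [g, hi]
  have hhead : ∀ b ∈ l.head?, b = u := by
    intro b hb
    rw [List.head?_eq_getElem?, List.getElem?_eq_getElem hpos] at hb
    simpa [hu, eq_comm] using hb
  have hlast : ∀ b ∈ l.getLast?, b = w := by
    intro b hb
    rw [List.getLast?_eq_getElem?, List.getElem?_eq_getElem (by omega)] at hb
    simpa [hw, eq_comm] using hb
  -- neighbours of the two ends lie on the path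
  have hnu : ∀ v ∈ A, G.Adj u v → v ∈ l := by
    intro v hv huv
    by_contra hvl
    have := hmax (v :: l) (List.isChain_cons.2 ⟨fun b hb => by rw [hhead b hb]; exact huv.symm, hl⟩)
      (List.nodup_cons.2 ⟨hvl, hnd⟩) (by simpa [hv] using hlA)
    simp at this
  have hnw : ∀ v ∈ A, G.Adj w v → v ∈ l := by
    intro v hv hwv
    by_contra hvl
    have := hmax (l ++ [v])
      (List.isChain_append.2 ⟨hl, by simp, fun a ha b hb => by
        rw [hlast a ha]
        obtain rfl : v = b := by simpa using hb
        exact hwv⟩)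
      (by rw [List.nodup_append]; simpa [hnd] using fun a ha => (fun h : a = v => hvl (h ▸ ha)))
      (by
        intro x hx
        rcases List.mem_append.1 hx with hx | hx
        · exact hlA x hx
        · rw [List.mem_singleton.1 hx]; exact hv)
    simp at this
  -- Each index set has at least `p` elements among `l.length - 1 ≤ 2p - 2` indices, so they share
  -- some `i`. The edges from `u` to `l[i+1]` and from `w` to `l[i]` then replace the path edge
  -- between `l[i]` and `l[i+1]` and close the path to a cycle.
  let I₁ := (range (l.length - 1)).filter fun i => G.Adj u (g (i + 1))
  let I₂ := (range (l.length - 1)).filter fun i => G.Adj w (g i)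
  have hI₁ : p ≤ #I₁ := by
    refine (hdeg u (hlA u (by rw [← hu]; exact List.getElem_mem _))).trans ?_
    refine (card_le_card (t := I₁.image fun i => g (i + 1)) ?_).trans card_image_le
    intro v hv
    rw [mem_filter] at hv
    obtain ⟨j, hj, hjv⟩ := List.mem_iff_getElem.1 (hnu v hv.1 hv.2)
    have hj0 : j ≠ 0 := by
      rintro rfl
      exact hv.2.ne (hu.symm.trans hjv)
    obtain ⟨i, rfl⟩ := Nat.exists_eq_succ_of_ne_zero hj0
    rw [hg] at hjv
    refine mem_image.2 ⟨i, mem_filter.2 ⟨mem_range.2 (by omega), ?_⟩, hjv⟩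
    rw [← Nat.succ_eq_add_one, hjv]
    exact hv.2
  have hI₂ : p ≤ #I₂ := by
    refine (hdeg w (hlA w (by rw [← hw]; exact List.getElem_mem _))).trans ?_
    refine (card_le_card (t := I₂.image g) ?_).trans card_image_le
    intro v hv
    rw [mem_filter] at hv
    obtain ⟨j, hj, hjv⟩ := List.mem_iff_getElem.1 (hnw v hv.1 hv.2)
    have hj0 : j ≠ l.length - 1 := by
      rintro rfl
      exact hv.2.ne (hw.symm.trans hjv)
    rw [hg] at hjv
    exact mem_image.2 ⟨j, mem_filter.2 ⟨mem_range.2 (by omega), hjv ▸ hv.2⟩, hjv⟩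
  obtain ⟨i, hi⟩ : (I₁ ∩ I₂).Nonempty := by
    refine inter_nonempty_of_card_lt_card_add_card (s := range (l.length - 1))
      (filter_subset _ _) (filter_subset _ _) ?_
    rw [card_range]
    omega
  obtain ⟨hi₁, hi₂⟩ := mem_inter.1 hi
  obtain ⟨hir, hi₁⟩ := mem_filter.1 hi₁
  have hi₂ := (mem_filter.1 hi₂).2
  have hir := mem_range.1 hir
  rw [← hg _ (by omega)] at hi₁ hi₂
  -- the vertices of the path carry a cycle
  let c := l.take (i + 1) ++ (l.drop (i + 1)).reverse
  have hperm : c.Perm l := by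
    conv_rhs => rw [← List.take_append_drop (i + 1) l]
    exact (List.perm_append_left_iff _).2 (List.reverse_perm _)
  have hc : c.IsChain G.Adj := by
    refine List.isChain_append.2 ⟨hl.take _, ?_, ?_⟩
    · rw [List.isChain_reverse]
      exact (hl.drop _).imp fun _ _ h => h.symm
    · intro x hx y hy
      have hxl : x = l[i] := by
        rw [List.getLast?_take] at hx
        simpa [show i < l.length by omega, eq_comm] using hx
      have hyw : y = w := by
        rw [List.head?_reverse, List.getLast?_drop, if_neg (by omega)] at hy
        exact hlast y hy
      rw [hxl, hyw]
      exact hi₂.symm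
  have hcl : ∀ a ∈ c.getLast?, ∀ b ∈ c.head?, G.Adj a b := by
    intro a ha b hb
    have hal : a = l[i + 1] := by
      rw [List.getLast?_append_of_ne_nil _ (by
        rw [Ne, List.reverse_eq_nil_iff, List.drop_eq_nil_iff]; omega)] at ha
      rw [List.getLast?_reverse, List.head?_drop, List.getElem?_eq_getElem (by omega)] at ha
      simpa [eq_comm] using ha
    have hbu : b = u := by
      refine hhead b ?_
      cases l with
      | nil => simp at hne
      | cons y l => simpa [c] using hb
    rw [hal, hbu]
    exact hi₁.symm
  -- An edge leaving the cycle would give a longer path: start at `z`, enter at `x` and go round the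
  -- whole cycle.
  intro x hx z hz hzl hxz
  obtain ⟨t, ht, htc⟩ := exists_chain_of_cycle hc hcl (hperm.mem_iff.2 hx)
  have htl := htc.trans hperm
  have := hmax (z :: x :: t) (List.isChain_cons_cons.2 ⟨hxz.symm, ht⟩)
    (List.nodup_cons.2 ⟨fun h => hzl (htl.mem_iff.1 h), htl.nodup_iff.2 hnd⟩)
    (by
      intro y hy
      rcases List.mem_cons.1 hy with rfl | hy
      · exact hz
      · exact hlA y (htl.mem_iff.1 hy))
  have := htl.length_eq
  simp at *
  omega

/-- Upper bound for the number of cliques in a graph without a path on `2 * p` vertices in terms of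
its matching number `t`; `Φ` is any function that pays for the removal of `k < 2 * p` vertices
together with a matching of `k / 2` edges. -/
theorem card_cliquesIn_le_of_free {V : Type} [DecidableEq V] {G : SimpleGraph V} {p r : ℕ}
    (hp : 1 ≤ p) (hfree : (P (2 * p)).Free G) {Φ : ℕ → ℤ} (hΦ0 : ∀ t, 0 ≤ Φ t)
    (hΦ : ∀ t k, 1 ≤ k → k < 2 * p → k / 2 ≤ t →
      Φ (t - k / 2) + (k.choose (r + 1) - (p - 1).choose r * k) ≤ Φ t)
    (A : Finset V) (t : ℕ) (ht : ∀ B ⊆ A, ∀ k, MatchedBy G B k → k ≤ t) :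
    (#(cliquesIn G (r + 1) A) : ℤ) ≤ (p - 1).choose r * #A + Φ t := by
  classical
  induction hn : #A using Nat.strong_induction_on generalizing A t with
  | _ n ih =>
  subst hn
  obtain rfl | hA := A.eq_empty_or_nonempty
  · have := card_cliquesIn_le_choose G (r + 1) (∅ : Finset V)
    rw [card_empty, Nat.choose_zero_succ, Nat.le_zero] at this
    rw [this, card_empty]
    simpa using hΦ0 t
  -- With minimum degree at least `p` a closed piece of fewer than `2p` vertices is split off, and
  -- its matching adds to any matching of the rest. Otherwise a vertex with at most `p - 1`
  -- neighbours is deleted.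
  by_cases hdeg : ∀ v ∈ A, p ≤ #(A.filter (G.Adj v))
  · obtain ⟨l, hl, hnd, hlA, hne, hlen, hclosed⟩ := exists_closed_chain hA hdeg hfree
    let X := l.toFinset
    have hXA : X ⊆ A := fun x hx => hlA x (List.mem_toFinset.1 hx)
    have hX : #X = l.length := List.toFinset_card_of_nodup hnd
    have hpos : 0 < l.length := List.length_pos_iff.2 hne
    have hcard : #(A \ X) + #X = #A := card_sdiff_add_card_eq_card hXA
    obtain ⟨B, hBX, hB⟩ := exists_matchedBy_of_isChain l hl hnd
    have h1 := ih #(A \ X) (by omega) (A \ X) (t - l.length / 2) (fun C hC k hk => by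
      have := ht (B ∪ C) (union_subset (hBX.trans hXA) (hC.trans sdiff_subset)) _
        (hB.union hk (Disjoint.mono hBX hC disjoint_sdiff))
      omega) rfl
    have h2 := card_cliquesIn_union_le G (r + 1) (A := X) (B := A \ X) fun v hv w hw =>
      hclosed v (List.mem_toFinset.1 hv) w (mem_sdiff.1 hw).1
        fun h => (mem_sdiff.1 hw).2 (List.mem_toFinset.2 h)
    rw [union_sdiff_of_subset hXA] at h2
    have h3 := card_cliquesIn_le_choose G (r + 1) X
    have h4 := hΦ t l.length hpos hlen (ht B (hBX.trans hXA) _ hB)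
    rw [← hcard]
    rw [hX] at h3 ⊢
    have h5 : (#(cliquesIn G (r + 1) A) : ℤ) ≤
        l.length.choose (r + 1) + #(cliquesIn G (r + 1) (A \ X)) := by
      exact_mod_cast h2.trans (Nat.add_le_add_right h3 _)
    push_cast
    linarith
  · push Not at hdeg
    obtain ⟨v, hv, hvd⟩ := hdeg
    have hcard := card_erase_add_one hv
    have h1 := ih #(A.erase v) (by omega) (A.erase v) t
      (fun C hC k hk => ht C (hC.trans (erase_subset _ _)) k hk) rfl
    have h2 := card_cliquesIn_insert_le G r (A := A.erase v) (v := v) (D := A.filter (G.Adj v))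
      fun w hw hvw => mem_filter.2 ⟨mem_of_mem_erase hw, hvw⟩
    rw [insert_erase hv] at h2
    have h3 : (#(A.filter (G.Adj v))).choose r ≤ (p - 1).choose r :=
      Nat.choose_le_choose r (by omega)
    have h4 : (#(cliquesIn G (r + 1) A) : ℤ) ≤
        #(cliquesIn G (r + 1) (A.erase v)) + (p - 1).choose r := by
      exact_mod_cast h2.trans (Nat.add_le_add_left h3 _)
    rw [← hcard]
    push_cast
    linarith

/-! ### A large complete bipartite subgraph -/

/-- A path alternating between two completely joined sets, starting at a prescribed vertex. -/
theorem exists_alternating_chain {V : Type} [DecidableEq V] {G : SimpleGraph V} :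
    ∀ (S : List V) (Y : Finset V), S.Nodup → S.length ≤ #Y → (∀ s ∈ S, s ∉ Y) →
      (∀ s ∈ S, ∀ y ∈ Y, G.Adj s y) →
      ∃ l : List V, l.head? = S.head? ∧ l.IsChain G.Adj ∧ l.Nodup ∧ l.length = 2 * S.length ∧
        ∀ x ∈ l, x ∈ S ∨ x ∈ Y
  | [], _, _, _, _, _ => ⟨[], by simp⟩
  | s :: S, Y, hnd, hlen, hdis, hadj => by
    have hY : 0 < #Y := by
      rw [List.length_cons] at hlen
      omega
    obtain ⟨y, hy⟩ := card_pos.1 hY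
    rw [List.nodup_cons] at hnd
    obtain ⟨l, hhead, hl, hlnd, hll, hmem⟩ := exists_alternating_chain S (Y.erase y) hnd.2
      (by rw [card_erase_of_mem hy]; rw [List.length_cons] at hlen; omega)
      (fun x hx h => hdis x (List.mem_cons_of_mem _ hx) (mem_of_mem_erase h))
      (fun x hx z hz => hadj x (List.mem_cons_of_mem _ hx) z (mem_of_mem_erase hz))
    have hs := hdis s List.mem_cons_self
    refine ⟨s :: y :: l, rfl, ?_, ?_, by simp [hll]; ring, ?_⟩
    · rw [List.isChain_cons_cons, List.isChain_cons]
      refine ⟨hadj s List.mem_cons_self y hy, fun b hb => ?_, hl⟩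
      rw [hhead] at hb
      exact (hadj b (List.mem_cons_of_mem _ (List.mem_of_mem_head? hb)) y hy).symm
    · rw [List.nodup_cons, List.nodup_cons]
      refine ⟨fun h => ?_, fun h => ?_, hlnd⟩
      · rcases List.mem_cons.1 h with rfl | h
        · exact hs hy
        · rcases hmem s h with h | h
          · exact hnd.1 h
          · exact hs (mem_of_mem_erase h)
      · rcases hmem y h with h | h
        · exact hdis y (List.mem_cons_of_mem _ h) hy
        · simp at h
    · intro x hx
      rw [List.mem_cons, List.mem_cons] at hx
      rcases hx with rfl | rfl | hx
      · exact .inl List.mem_cons_self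
      · exact .inr hy
      · exact (hmem x hx).imp (List.mem_cons_of_mem _) mem_of_mem_erase

theorem exists_alternating_chain_of_mem {V : Type} [DecidableEq V] {G : SimpleGraph V}
    {S Y : Finset V} (hSY : #S ≤ #Y) (hdis : Disjoint S Y) (hadj : ∀ s ∈ S, ∀ y ∈ Y, G.Adj s y)
    {s : V} (hs : s ∈ S) :
    ∃ l : List V, l.head? = some s ∧ l.IsChain G.Adj ∧ l.Nodup ∧ l.length = 2 * #S ∧
      ∀ x ∈ l, x ∈ S ∨ x ∈ Y := by
  have hmem : ∀ x, x ∈ s :: (S.erase s).toList ↔ x ∈ S := by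
    intro x
    rw [List.mem_cons, mem_toList, mem_erase]
    by_cases h : x = s <;> simp [h, hs]
  have hlen : (s :: (S.erase s).toList).length = #S := by
    rw [List.length_cons, length_toList, card_erase_add_one hs]
  obtain ⟨l, h1, h2, h3, h4, h5⟩ := exists_alternating_chain (G := G) (s :: (S.erase s).toList) Y
    (by simp [nodup_toList]) (by rw [hlen]; exact hSY)
    (fun x hx => Finset.disjoint_left.1 hdis ((hmem x).1 hx))
    (fun x hx y hy => hadj x ((hmem x).1 hx) y hy)
  exact ⟨l, h1, h2, h3, by rw [h4, hlen], fun x hx => (h5 x hx).imp_left (hmem x).1⟩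

/-- If the `p - 1` vertices of `S` have `p + 1` common neighbours in a graph without a path on
`2 * p` vertices, then an outside neighbour of `S` has all its neighbours in `S`. -/
theorem mem_of_adj_of_adj_star {V : Type} [DecidableEq V] {G : SimpleGraph V} {p : ℕ}
    (hfree : (P (2 * p)).Free G) {S Y : Finset V} (hS : #S + 1 = p) (hY : p + 1 ≤ #Y)
    (hdis : Disjoint S Y) (hadj : ∀ s ∈ S, ∀ y ∈ Y, G.Adj s y) {s v w : V} (hs : s ∈ S)
    (hv : v ∉ S) (hsv : G.Adj v s) (hvw : G.Adj v w) : w ∈ S := by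
  by_contra hw
  -- Without `v` and `w` there are still `p - 1` common neighbours, enough for an alternating path
  -- through all of `S` from `s`. Prefixing `w, v` gives `2 + 2(p-1) = 2p` vertices.
  obtain ⟨l, h1, h2, h3, h4, h5⟩ := exists_alternating_chain_of_mem (G := G) (S := S)
    (Y := (Y.erase v).erase w)
    (by
      have := pred_card_le_card_erase (s := Y) (a := v)
      have := pred_card_le_card_erase (s := Y.erase v) (a := w)
      omega)
    (hdis.mono_right ((erase_subset _ _).trans (erase_subset _ _)))
    (fun x hx y hy => hadj x hx y (mem_of_mem_erase (mem_of_mem_erase hy))) hs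
  refine hfree (P_isContained_of_isChain (l := w :: v :: l) ?_ ?_ ?_)
  · rw [List.isChain_cons_cons, List.isChain_cons]
    refine ⟨hvw.symm, fun b hb => ?_, h2⟩
    rw [h1] at hb
    obtain rfl : s = b := by simpa using hb
    exact hsv
  · rw [List.nodup_cons, List.nodup_cons, List.mem_cons]
    refine ⟨?_, fun h => ?_, h3⟩
    · rintro (h | h)
      · exact hvw.ne h.symm
      · rcases h5 w h with h | h
        · exact hw h
        · simp at h
    · rcases h5 v h with h | h
      · exact hv h
      · simp at h
  · simp only [List.length_cons]
    omega

/-- The vertex set splits into `S`, its outside neighbours `T`, and the rest `R`. Vertices of `T`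
see only `S`, and no edge joins `S` to `R`, so the three contributions are bounded separately. -/
theorem card_cliquesIn_le_of_star {V : Type} [Fintype V] [DecidableEq V] {G : SimpleGraph V}
    {p r s : ℕ} (hp : 2 ≤ p) (hfree : (P (2 * p)).Free G)
    (hs : ∀ B k, MatchedBy G B k → k ≤ s) {Φ : ℕ → ℤ} (hΦ0 : ∀ t, 0 ≤ Φ t)
    (hΦ : ∀ t k, 1 ≤ k → k < 2 * p → k / 2 ≤ t →
      Φ (t - k / 2) + (k.choose (r + 1) - (p - 1).choose r * k) ≤ Φ t)
    {S Y : Finset V} (hS : #S + 1 = p) (hY : p + 1 ≤ #Y)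
    (hdis : Disjoint S Y) (hadj : ∀ s ∈ S, ∀ y ∈ Y, G.Adj s y) :
    (#(cliquesIn G (r + 1) univ) : ℤ) ≤ (p - 1).choose r * (Fintype.card V - (p - 1 : ℕ)) +
      (p - 1).choose (r + 1) + Φ (s - (p - 1)) := by
  classical
  let T : Finset V := univ.filter fun v => v ∉ S ∧ ∃ s ∈ S, G.Adj v s
  let R : Finset V := univ.filter fun v => v ∉ S ∧ ∀ s ∈ S, ¬ G.Adj v s
  have hT : ∀ v ∈ T, ∀ w, G.Adj v w → w ∈ S := by
    intro v hv w hvw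
    obtain ⟨-, hvS, x, hx, hvx⟩ := mem_filter.1 hv
    exact mem_of_adj_of_adj_star hfree hS hY hdis hadj hx hvS hvx hvw
  have hSR : Disjoint S R := Finset.disjoint_right.2 fun v hv => (mem_filter.1 hv).2.1
  have hSRT : Disjoint (S ∪ R) T := by
    rw [Finset.disjoint_left]
    intro v hv hvT
    obtain ⟨-, hvS, x, hx, hvx⟩ := mem_filter.1 hvT
    rcases mem_union.1 hv with h | h
    · exact hvS h
    · exact (mem_filter.1 h).2.2 x hx hvx
  have huniv : (S ∪ R) ∪ T = univ := by
    ext v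
    simp only [mem_union, mem_filter, mem_univ, true_and, iff_true, R, T]
    by_cases h1 : v ∈ S
    · exact .inl (.inl h1)
    · by_cases h2 : ∃ s ∈ S, G.Adj v s
      · exact .inr ⟨h1, h2⟩
      · push Not at h2
        exact .inl (.inr ⟨h1, h2⟩)
  have hcard : #S + #R + #T = Fintype.card V := by
    rw [← card_union_of_disjoint hSR, ← card_union_of_disjoint hSRT, huniv, card_univ]
  have h1 := card_cliquesIn_union_le_of_degree_le G r (p - 1) (S ∪ R) T
    fun v hv => ⟨S, by omega, fun w _ hvw => hT v hv w hvw⟩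
  rw [huniv] at h1
  have h2 := card_cliquesIn_union_le G (r + 1) (A := S) (B := R)
    fun v hv w hw hvw => (mem_filter.1 hw).2.2 v hv hvw.symm
  have h3 := card_cliquesIn_le_choose G (r + 1) S
  rw [show #S = p - 1 by omega] at h3
  have hR := card_cliquesIn_le_of_free (by omega) hfree hΦ0 hΦ R (s - (p - 1)) fun B hB k hk => by
    -- The alternating path through `S` and `Y` carries `p - 1` independent edges away from `R`,
    -- leaving at most `s - (p - 1)` for a matching in `R`.
    obtain ⟨x, hx⟩ : S.Nonempty := card_pos.1 (by omega)
    obtain ⟨l, -, hl, hnd, hlen, hlSY⟩ := exists_alternating_chain_of_mem (by omega) hdis hadj hx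
    obtain ⟨C, hC, hCm⟩ := exists_matchedBy_of_isChain l hl hnd
    have hCB : Disjoint C B := by
      rw [Finset.disjoint_left]
      intro z hzC hzB
      have hzR := (mem_filter.1 (hB hzB)).2
      rcases hlSY z (List.mem_toFinset.1 (hC hzC)) with h | h
      · exact hzR.1 h
      · exact hzR.2 x hx (hadj x hx z h).symm
    have := hs _ _ (hCm.union hk hCB)
    omega
  have h4 : (#(cliquesIn G (r + 1) univ) : ℤ) ≤
      (p - 1).choose (r + 1) + #(cliquesIn G (r + 1) R) + (p - 1).choose r * #T := by
    exact_mod_cast h1.trans (Nat.add_le_add_right (h2.trans (Nat.add_le_add_right h3 _)) _)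
  have h5 : (Fintype.card V : ℤ) - (p - 1 : ℕ) = #R + #T := by
    rw [← hcard, show #S = p - 1 by omega]
    push_cast
    ring
  rw [h5]
  linarith

/-- `U` is the vertex set of a maximum matching; an edge missing it would enlarge the matching. -/
theorem exists_cover_of_matchedBy_le {V : Type} [DecidableEq V] {G : SimpleGraph V} {s : ℕ}
    (hs : ∀ B k, MatchedBy G B k → k ≤ s) :
    ∃ U : Finset V, #U ≤ 2 * s ∧ ∀ v w, G.Adj v w → v ∈ U ∨ w ∈ U := by
  classical
  obtain ⟨U, hU⟩ := Nat.findGreatest_spec (P := fun k => ∃ B, MatchedBy G B k) (Nat.zero_le s)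
    ⟨∅, .empty⟩
  refine ⟨U, by rw [hU.card_eq]; exact Nat.mul_le_mul_left _ (Nat.findGreatest_le _), ?_⟩
  intro v w hvw
  by_contra! h
  have h1 := hU.insert_edge hvw h.1 h.2
  have := Nat.le_findGreatest (P := fun k => ∃ B, MatchedBy G B k) (hs _ _ h1) ⟨_, h1⟩
  omega

/-- A graph with bounded matching number either has `p - 1` vertices with many common neighbours,
or the number of its cliques is small. -/
theorem exists_star_or_card_cliquesIn_le {V : Type} [Fintype V] [DecidableEq V] {G : SimpleGraph V}
    {p r s : ℕ} (hp : 2 ≤ p) (hr : 1 ≤ r) (hrp : r + 1 ≤ p)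
    (hs : ∀ B k, MatchedBy G B k → k ≤ s)
    (hn : 2 ^ (2 * s + 2 ^ (2 * s) * p) + (p - 1).choose r * (p - 1) ≤ Fintype.card V) :
    (∃ S Y : Finset V, #S + 1 = p ∧ p + 1 ≤ #Y ∧ Disjoint S Y ∧ ∀ s ∈ S, ∀ y ∈ Y, G.Adj s y) ∨
    (#(cliquesIn G (r + 1) univ) : ℤ) ≤ (p - 1).choose r * (Fintype.card V - (p - 1 : ℕ)) := by
  classical
  obtain ⟨U, hUcard, hU⟩ := exists_cover_of_matchedBy_le hs
  have hnbr : ∀ y ∉ U, ∀ w, G.Adj y w → w ∈ U := fun y hy w h => (hU y w h).resolve_left hy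
  let Y : Finset V := univ.filter fun y => y ∉ U ∧ p - 1 ≤ #(univ.filter (G.Adj y))
  by_cases hY : 2 ^ (2 * s) * p < #Y
  · left
    have hch : ∀ y, ∃ S : Finset V, y ∈ Y → S ⊆ univ.filter (G.Adj y) ∧ #S = p - 1 := by
      intro y
      by_cases hy : y ∈ Y
      · obtain ⟨S, hS, hS'⟩ := exists_subset_card_eq (mem_filter.1 hy).2.2
        exact ⟨S, fun _ => ⟨hS, hS'⟩⟩
      · exact ⟨∅, fun h => absurd h hy⟩
    choose f hf using hch
    have hSU : ∀ y ∈ Y, f y ⊆ U := fun y hy x hx =>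
      hnbr y (mem_filter.1 hy).2.1 x (mem_filter.1 ((hf y hy).1 hx)).2
    -- The chosen neighbour sets lie in `U`, which has at most `2 ^ (2 * s)` subsets, so one of them
    -- is chosen more than `p` times.
    obtain ⟨S, hSmem, hS⟩ := exists_lt_card_fiber_of_mul_lt_card_of_maps_to (s := Y)
      (t := U.powerset) (f := f) (n := p) (fun y hy => mem_powerset.2 (hSU y hy)) (by
        rw [card_powerset]
        exact (Nat.mul_le_mul_right _ (Nat.pow_le_pow_right (by norm_num) hUcard)).trans_lt hY)
    obtain ⟨y, hy⟩ := card_pos.1 ((Nat.zero_le _).trans_lt hS)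
    obtain ⟨hyY, rfl⟩ := mem_filter.1 hy
    refine ⟨f y, Y.filter fun x => f x = f y, by rw [(hf y hyY).2]; omega, hS, ?_, ?_⟩
    · rw [Finset.disjoint_left]
      intro x hx hx'
      exact (mem_filter.1 (mem_filter.1 hx').1).2.1 (hSU y hyY hx)
    · intro x hx z hz
      obtain ⟨hz, hzy⟩ := mem_filter.1 hz
      exact (mem_filter.1 ((hf z hz).1 (hzy ▸ hx))).2.symm
  · right
    push Not at hY
    have h1 := card_cliquesIn_union_le_of_degree_le G r (p - 2) (U ∪ Y) (univ \ (U ∪ Y))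
      fun v hv => by
        refine ⟨univ.filter (G.Adj v), ?_, fun w _ hvw => mem_filter.2 ⟨mem_univ _, hvw⟩⟩
        by_contra! h
        simp only [mem_sdiff, mem_univ, true_and, mem_union, not_or, Y, mem_filter, not_and] at hv
        exact hv.2 hv.1 (by omega)
    rw [union_sdiff_of_subset (subset_univ _)] at h1
    have h2 := card_cliquesIn_le_two_pow G (r + 1) (U ∪ Y)
    have h3 : #(U ∪ Y) ≤ 2 * s + 2 ^ (2 * s) * p :=
      (card_union_le _ _).trans (add_le_add hUcard hY)
    have h4 : 2 ^ #(U ∪ Y) ≤ 2 ^ (2 * s + 2 ^ (2 * s) * p) :=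
      Nat.pow_le_pow_right (by norm_num) h3
    have h5 : #(univ \ (U ∪ Y)) ≤ Fintype.card V := card_le_univ _
    -- Strict because `1 ≤ r ≤ p - 1`. The saving of at least one clique per vertex absorbs the
    -- constant number of cliques inside `U ∪ Y` once `n` is large.
    have h6 : (p - 2).choose r + 1 ≤ (p - 1).choose r := by
      obtain ⟨q, rfl⟩ := Nat.exists_eq_add_of_le hp
      obtain ⟨i, rfl⟩ := Nat.exists_eq_add_of_le hr
      rw [show 2 + q - 1 = q + 1 by omega, show 2 + q - 2 = q by omega, add_comm 1 i,
        Nat.choose_succ_succ']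
      have : 0 < q.choose i := Nat.choose_pos (by omega)
      omega
    have h7 := Nat.mul_le_mul_left ((p - 2).choose r) h5
    have h8 := Nat.mul_le_mul_right (Fintype.card V) h6
    rw [mul_sub]
    rw [le_sub_iff_add_le]
    have h9 : #(cliquesIn G (r + 1) univ) + (p - 1).choose r * (p - 1) ≤
      (p - 1).choose r * Fintype.card V := by linarith
    exact_mod_cast h9

/-! ### Convexity -/

/-- The increments of a convex sequence increase, so a shift by `d` gains at least as much from `j`
as from `i`. -/
theorem add_le_add_of_convex {F : ℕ → ℤ} (hF : ∀ k, 2 * F (k + 1) ≤ F k + F (k + 2)) {i j : ℕ}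
    (hij : i ≤ j) (d : ℕ) : F (i + d) + F j ≤ F i + F (j + d) := by
  have hmono : Monotone fun k => F (k + 1) - F k :=
    monotone_nat_of_le_succ fun k => by linarith [hF k]
  induction d with
  | zero => simp
  | succ d ih =>
    have := hmono (show i + d ≤ j + d by omega)
    simp only at this
    rw [← add_assoc, ← add_assoc]
    linarith

/-- The largest total value of `⌊t / q⌋` parts of size `q` and one part of size `t % q`. -/
def splitValue (H : ℕ → ℤ) (q t : ℕ) : ℤ := (t / q : ℕ) * H q + H (t % q)

/-- The part of size `j` is merged with the remainder `u = t % q`. If they fit into one part, this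
is superadditivity from `H 0 = 0`; if not, convexity favours the more unequal pair `q` and `u + j -
q`. -/
theorem splitValue_add_le {H : ℕ → ℤ} (hH : ∀ k, 2 * H (k + 1) ≤ H k + H (k + 2)) (hH0 : H 0 = 0)
    {q : ℕ} (hq : 1 ≤ q) (t : ℕ) {j : ℕ} (hj : j ≤ q) :
    splitValue H q t + H j ≤ splitValue H q (t + j) := by
  unfold splitValue
  have hu : t % q < q := Nat.mod_lt _ hq
  have ht := Nat.div_add_mod t q
  generalize t % q = u at *
  generalize t / q = m at *
  subst ht
  by_cases h : u + j < q
  · have h1 := add_le_add_of_convex hH (Nat.zero_le j) u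
    rw [add_assoc (q * m), Nat.mul_add_div hq, Nat.mul_add_mod, Nat.div_eq_of_lt h, Nat.mod_eq_of_lt h]
    rw [zero_add, hH0, add_comm j u] at h1
    simp only [add_zero]
    linarith
  · obtain ⟨i, hi⟩ := Nat.exists_eq_add_of_le (not_lt.1 h)
    have h1 := add_le_add_of_convex hH (show i ≤ j by omega) (q - j)
    rw [show i + (q - j) = u by omega, show j + (q - j) = q by omega] at h1
    rw [show q * m + u + j = q * (m + 1) + i by rw [add_assoc, hi]; ring, Nat.mul_add_div hq,
      Nat.mul_add_mod, Nat.div_eq_of_lt (by omega), Nat.mod_eq_of_lt (by omega)]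
    push_cast
    linarith

/-- The gain of `K_k` over `k` vertices that each lie in `c` cliques of size `r + 1`, if positive. -/
def cliqueGain (c r k : ℕ) : ℤ := max 0 (k.choose (r + 1) - c * k)

/-- By Pascal's rule `k.choose (r + 1)` has increasing increments `k.choose r`; subtracting a linear
term and taking the maximum with zero keep convexity. -/
theorem cliqueGain_convex (c r k : ℕ) :
    2 * cliqueGain c r (k + 1) ≤ cliqueGain c r k + cliqueGain c r (k + 2) := by
  have h1 : (k + 1).choose (r + 1) = k.choose r + k.choose (r + 1) := Nat.choose_succ_succ _ _
  have h2 : (k + 2).choose (r + 1) = (k + 1).choose r + (k + 1).choose (r + 1) :=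
    Nat.choose_succ_succ _ _
  have h3 : k.choose r ≤ (k + 1).choose r := Nat.choose_le_choose r (Nat.le_succ k)
  unfold cliqueGain
  rw [h2, h1]
  zify at h3
  push_cast
  have e1 := le_max_left (0 : ℤ) (k.choose (r + 1) - c * k)
  have e2 := le_max_right (0 : ℤ) (k.choose (r + 1) - c * k)
  have e3 := le_max_left (0 : ℤ)
    ((k + 1).choose r + (k.choose r + k.choose (r + 1)) - c * (k + 2))
  have e4 := le_max_right (0 : ℤ)
    ((k + 1).choose r + (k.choose r + k.choose (r + 1)) - c * (k + 2))
  rcases max_cases (0 : ℤ) (k.choose r + k.choose (r + 1) - c * (k + 1)) with h | h <;>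
    linarith

theorem cliqueGain_mono (c r : ℕ) : Monotone (cliqueGain c r) := by
  refine monotone_nat_of_le_succ fun k => ?_
  have h := add_le_add_of_convex (cliqueGain_convex c r) (Nat.zero_le k) 1
  have h0 : cliqueGain c r 0 = 0 := by simp [cliqueGain]
  have h1 : 0 ≤ cliqueGain c r (0 + 1) := le_max_left _ _
  linarith

theorem cliqueGain_odd_convex (c r k : ℕ) :
    2 * cliqueGain c r (2 * (k + 1) + 1) ≤
      cliqueGain c r (2 * k + 1) + cliqueGain c r (2 * (k + 2) + 1) := by
  have h := add_le_add_of_convex (cliqueGain_convex c r)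
    (show 2 * k + 1 ≤ 2 * (k + 1) + 1 by omega) 2
  rw [show 2 * k + 1 + 2 = 2 * (k + 1) + 1 by ring,
    show 2 * (k + 1) + 1 + 2 = 2 * (k + 2) + 1 by ring] at h
  linarith

/-- Supplies `H 0 = 0` for `H j = cliqueGain c r (2 * j + 1)`: isolated vertices gain nothing over
the rate `c`. -/
theorem cliqueGain_one {c : ℕ} (hc : 1 ≤ c) (r : ℕ) : cliqueGain c r 1 = 0 := by
  have h : Nat.choose 1 (r + 1) ≤ 1 := by
    rcases r with _ | r
    · rfl
    · rw [Nat.choose_eq_zero_of_lt (by omega)]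
      exact Nat.zero_le 1
  unfold cliqueGain
  zify at h hc
  push_cast
  exact max_eq_left (by linarith)

/-- The bound for the clique gain of a graph of matching number `t` without a path on
`2 * p` vertices. -/
def gainBound (p r t : ℕ) : ℤ :=
  splitValue (fun j => cliqueGain ((p - 1).choose r) r (2 * j + 1)) (p - 1) t

theorem gainBound_nonneg (p r t : ℕ) : 0 ≤ gainBound p r t := by
  have h : ∀ k, 0 ≤ cliqueGain ((p - 1).choose r) r k := fun k => le_max_left _ _
  unfold gainBound splitValue
  have := h (2 * (p - 1) + 1)
  have := h (2 * (t % (p - 1)) + 1)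
  positivity

/-- A piece of `k` vertices with `j = k / 2` has at most `2 * j + 1` vertices, so monotonicity
bounds its gain by that of `K_{2j+1}`. -/
theorem gainBound_step {p r : ℕ} (hp : 2 ≤ p) (hrp : r + 1 ≤ p) (t k : ℕ) (hk : k < 2 * p)
    (hkt : k / 2 ≤ t) :
    gainBound p r (t - k / 2) + (k.choose (r + 1) - (p - 1).choose r * k) ≤ gainBound p r t := by
  have h1 := splitValue_add_le (cliqueGain_odd_convex ((p - 1).choose r) r)
    (cliqueGain_one (Nat.choose_pos (by omega)) r) (show 1 ≤ p - 1 by omega) (t - k / 2)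
    (show k / 2 ≤ p - 1 by omega)
  rw [Nat.sub_add_cancel hkt] at h1
  have h2 : (k.choose (r + 1) - (p - 1).choose r * k : ℤ) ≤ cliqueGain ((p - 1).choose r) r k :=
    le_max_right _ _
  have h3 := cliqueGain_mono ((p - 1).choose r) r (show k ≤ 2 * (k / 2) + 1 by omega)
  unfold gainBound
  linarith

/-- Vandermonde's sum for `(2 * q).choose i` has `i + 1` terms. Each is at least `q.choose i`, since
choosing `x.1` and then `x.2` further elements from one `q`-set yields every `i`-subset. -/
theorem mul_choose_le_choose_two_mul (q i : ℕ) :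
    (i + 1) * q.choose i ≤ (2 * q).choose i := by
  rw [two_mul, Nat.add_choose_eq]
  calc (i + 1) * q.choose i = ∑ _x ∈ antidiagonal i, q.choose i := by simp
    _ ≤ _ := sum_le_sum fun x hx => ?_
  rw [HasAntidiagonal.mem_antidiagonal] at hx
  have h1 := Nat.choose_mul (n := q) (show x.1 ≤ i by omega)
  rw [show i - x.1 = x.2 by omega] at h1
  calc q.choose i ≤ q.choose i * i.choose x.1 :=
        Nat.le_mul_of_pos_right _ (Nat.choose_pos (by omega))
    _ = q.choose x.1 * (q - x.1).choose x.2 := h1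
    _ ≤ _ := Nat.mul_le_mul_left _ (Nat.choose_le_choose _ (Nat.sub_le _ _))

/-- With `q = p - 1` this says that `K_{2p-1}` has nonnegative gain, so no cut-off at zero is needed
for full parts. -/
theorem mul_choose_le_choose_succ (q r : ℕ) :
    q.choose r * (2 * q + 1) ≤ (2 * q + 1).choose (r + 1) := by
  have h1 := Nat.add_one_mul_choose_eq (2 * q) r
  have h2 := mul_choose_le_choose_two_mul q r
  refine Nat.le_of_mul_le_mul_right ?_ (show 0 < r + 1 from Nat.succ_pos r)
  calc _ = (2 * q + 1) * ((r + 1) * q.choose r) := by ring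
    _ ≤ _ := Nat.mul_le_mul_left _ h2
    _ = _ := h1

theorem gainBound_mul_add {p r a b : ℕ} (hrp : r + 1 ≤ p) (hb : b < p - 1) :
    gainBound p r (a * (p - 1) + b) =
      a * ((2 * p - 1).choose (r + 1) - (p - 1).choose r * (2 * p - 1 : ℕ)) +
        max (0 : ℤ) ((2 * b + 1).choose (r + 1) - (p - 1).choose r * (2 * b + 1 : ℕ)) := by
  unfold gainBound splitValue
  have hq : 0 < p - 1 := by omega
  rw [mul_comm a, Nat.mul_add_div hq, Nat.mul_add_mod, Nat.div_eq_of_lt hb, Nat.mod_eq_of_lt hb,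
    add_zero]
  have h := mul_choose_le_choose_succ (p - 1) r
  rw [show 2 * (p - 1) + 1 = 2 * p - 1 by omega] at h
  simp only [cliqueGain]
  rw [show 2 * (p - 1) + 1 = 2 * p - 1 by omega]
  congr 2
  refine max_eq_right ?_
  zify at h
  linarith

/-! ### Lower bounds for clique counts -/

theorem card_cliquesIn_map_le {V W : Type} {G : SimpleGraph V} {H : SimpleGraph W} (e : G ↪g H)
    (r : ℕ) (A : Finset V) :
    #(cliquesIn G r A) ≤ #(cliquesIn H r (A.map e.toEmbedding)) := by
  refine card_le_card_of_injOn (fun s => s.map e.toEmbedding) ?_ ?_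
  · intro s hs
    rw [mem_coe, mem_cliquesIn, isNClique_iff] at hs ⊢
    refine ⟨map_subset_map.2 hs.1, ?_, by rw [card_map, hs.2.2]⟩
    rw [coe_map]
    rintro _ ⟨x, hx, rfl⟩ _ ⟨y, hy, rfl⟩ hxy
    exact e.map_adj_iff.2 (hs.2.1 hx hy fun h => hxy (h ▸ rfl))
  · exact fun s _ t _ h => map_injective _ h

theorem N_K_le_of_embedding {V W : Type} [Fintype V] [Fintype W] {G : SimpleGraph V}
    {H : SimpleGraph W} (e : G ↪g H) (r : ℕ) : N (K r) G ≤ N (K r) H := by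
  rw [N_K_eq_card_cliquesIn, N_K_eq_card_cliquesIn]
  refine (card_cliquesIn_map_le e r univ).trans (card_le_card fun s hs => ?_)
  rw [mem_cliquesIn] at hs ⊢
  exact ⟨subset_univ _, hs.2⟩

/-- Cliques in disjoint sets are distinct because they are nonempty; hence the size `r + 1`. -/
theorem sum_card_cliquesIn_le {V ι : Type} [Fintype V] (G : SimpleGraph V) (r : ℕ) (T : Finset ι)
    (A : ι → Finset V) (hA : ∀ i ∈ T, ∀ j ∈ T, i ≠ j → Disjoint (A i) (A j)) :
    ∑ i ∈ T, #(cliquesIn G (r + 1) (A i)) ≤ N (K (r + 1)) G := by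
  classical
  rw [N_K_eq_card_cliquesIn, ← card_biUnion]
  · refine card_le_card fun s hs => ?_
    obtain ⟨i, -, hs⟩ := mem_biUnion.1 hs
    rw [mem_cliquesIn] at hs ⊢
    exact ⟨subset_univ _, hs.2⟩
  · intro i hi j hj hij
    rw [Function.onFun, Finset.disjoint_left]
    intro s hsi hsj
    rw [mem_cliquesIn] at hsi hsj
    obtain ⟨x, hx⟩ : s.Nonempty := card_pos.1 (by rw [hsi.2.card_eq]; exact Nat.succ_pos r)
    exact Finset.disjoint_left.1 (hA i hi j hj hij) (hsi.1 hx) (hsj.1 hx)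

theorem N_K_add_le_N_K_sum {V W : Type} [Fintype V] [Fintype W] (G : SimpleGraph V)
    (H : SimpleGraph W) (r : ℕ) :
    N (K (r + 1)) G + N (K (r + 1)) H ≤ N (K (r + 1)) (G ⊕g H) := by
  let e₁ : G ↪g G ⊕g H := Embedding.sumInl
  let e₂ : H ↪g G ⊕g H := Embedding.sumInr
  have h := sum_card_cliquesIn_le (G ⊕g H) r (univ : Finset Bool)
    (fun i => if i then univ.map e₁.toEmbedding else univ.map e₂.toEmbedding) (by
      have : Disjoint (univ.map e₁.toEmbedding) (univ.map e₂.toEmbedding) := by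
        rw [Finset.disjoint_left]
        rintro _ hx hy
        obtain ⟨x, -, rfl⟩ := mem_map.1 hx
        obtain ⟨y, -, hy⟩ := mem_map.1 hy
        exact Sum.inr_ne_inl hy
      rintro (_ | _) - (_ | _) - hij
      · exact absurd rfl hij
      · simpa using this.symm
      · simpa using this
      · exact absurd rfl hij)
  rw [Fintype.sum_bool] at h
  rw [N_K_eq_card_cliquesIn G, N_K_eq_card_cliquesIn H]
  exact (add_le_add (card_cliquesIn_map_le e₁ _ _) (card_cliquesIn_map_le e₂ _ _)).trans
    (by simpa using h)

theorem mul_N_K_le_N_K_copies {V : Type} [Fintype V] (a : ℕ) (G : SimpleGraph V) (r : ℕ) :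
    a * N (K (r + 1)) G ≤ N (K (r + 1)) (copies a G) := by
  let e : Fin a → (G ↪g copies a G) := fun i =>
    ⟨⟨fun v => (i, v), fun v w h => (Prod.ext_iff.1 h).2⟩, fun {_ _} => ⟨fun h => h.2, fun h => ⟨rfl, h⟩⟩⟩
  have h := sum_card_cliquesIn_le (copies a G) r univ (fun i => univ.map (e i).toEmbedding) (by
    intro i _ j _ hij
    rw [Finset.disjoint_left]
    rintro _ hx hy
    obtain ⟨x, -, rfl⟩ := mem_map.1 hx
    obtain ⟨y, -, hy⟩ := mem_map.1 hy
    exact hij (Prod.ext_iff.1 hy).1.symm)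
  refine le_trans ?_ h
  rw [N_K_eq_card_cliquesIn G]
  calc _ = ∑ _i : Fin a, #(cliquesIn G (r + 1) univ) := by simp
    _ ≤ _ := sum_le_sum fun i _ => card_cliquesIn_map_le (e i) _ _

theorem N_K_K (r m : ℕ) : N (K r) (K m) = m.choose r := by
  rw [N_K_eq_card_cliquesIn, card_cliquesIn_eq_choose, card_univ, Fintype.card_fin]
  exact fun _ _ _ _ h => h

theorem le_card_cliquesIn_insert {V : Type} [DecidableEq V] {G : SimpleGraph V} {r : ℕ}
    {S A : Finset V} (hS : G.IsClique (S : Set V)) (hSA : S ⊆ A) {v : V} (hv : v ∉ A)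
    (hvS : ∀ s ∈ S, G.Adj v s) :
    #(cliquesIn G (r + 1) A) + (#S).choose r ≤ #(cliquesIn G (r + 1) (insert v A)) := by
  classical
  have hinj : Set.InjOn (insert v) (powersetCard r S : Set (Finset V)) := by
    intro s hs t ht hst
    rw [mem_coe, mem_powersetCard] at hs ht
    have h1 : v ∉ s := fun h => hv (hSA (hs.1 h))
    have h2 : v ∉ t := fun h => hv (hSA (ht.1 h))
    rw [← erase_insert h1, ← erase_insert h2]
    exact congrArg (fun s => s.erase v) hst
  rw [← card_powersetCard, ← card_image_of_injOn hinj, ← card_union_of_disjoint]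
  · refine card_le_card (union_subset ?_ ?_)
    · intro s hs
      rw [mem_cliquesIn] at hs ⊢
      exact ⟨hs.1.trans (subset_insert _ _), hs.2⟩
    · intro s hs
      obtain ⟨t, ht, rfl⟩ := mem_image.1 hs
      rw [mem_powersetCard] at ht
      rw [mem_cliquesIn]
      refine ⟨insert_subset_insert _ (ht.1.trans hSA), ?_⟩
      exact (isNClique_iff _ |>.2 ⟨hS.subset (by exact_mod_cast ht.1), ht.2⟩).insert
        fun x hx => hvS x (ht.1 hx)
  · rw [Finset.disjoint_left]
    intro s hs hs'
    rw [mem_cliquesIn] at hs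
    obtain ⟨t, -, rfl⟩ := mem_image.1 hs'
    exact hv (hs.1 (mem_insert_self _ _))

theorem le_N_K_join (r q m : ℕ) :
    q.choose (r + 1) + q.choose r * m ≤ N (K (r + 1)) (join (K q) (I m)) := by
  classical
  let S : Finset (Fin q ⊕ Fin m) := univ.map ⟨Sum.inl, Sum.inl_injective⟩
  have hScard : #S = q := by simp [S]
  have hS : (join (K q) (I m)).IsClique (S : Set (Fin q ⊕ Fin m)) := by
    intro x hx y hy hxy
    obtain ⟨x, -, rfl⟩ := mem_map.1 (mem_coe.1 hx)
    obtain ⟨y, -, rfl⟩ := mem_map.1 (mem_coe.1 hy)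
    exact fun h => hxy (congrArg Sum.inl h)
  have key : ∀ B : Finset (Fin m), q.choose (r + 1) + q.choose r * #B ≤
      #(cliquesIn (join (K q) (I m)) (r + 1) (S ∪ B.image Sum.inr)) := by
    intro B
    induction B using Finset.induction_on with
    | empty => simp [card_cliquesIn_eq_choose _ hS, hScard]
    | insert v B hv ih =>
      have h := le_card_cliquesIn_insert (r := r) hS
        (subset_union_left (s₂ := B.image Sum.inr)) (v := Sum.inr v)
        (by simp [S, hv]) (by
          intro s hs
          obtain ⟨x, -, rfl⟩ := mem_map.1 hs
          trivial)
      rw [image_insert, union_insert, card_insert_of_notMem hv]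
      rw [hScard] at h
      linarith
  have h := key univ
  rw [card_univ, Fintype.card_fin] at h
  rw [N_K_eq_card_cliquesIn]
  refine h.trans (card_le_card fun s hs => ?_)
  rw [mem_cliquesIn] at hs ⊢
  exact ⟨subset_univ _, hs.2⟩

/-! ### The extremal graphs -/

/-- The graph `(K_{p-1} ∨ I_m) ∪ a K_{2p-1} ∪ K_q`. -/
abbrev extremalGraph (m p a q : ℕ) :
    SimpleGraph (((Fin (p - 1) ⊕ Fin m) ⊕ (Fin a × Fin (2 * p - 1))) ⊕ Fin q) :=
  (join (K (p - 1)) (I m) ⊕g copies a (K (2 * p - 1))) ⊕g K q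

/-- The component of a vertex of `extremalGraph`. -/
def extremalPart {m p a q : ℕ} :
    ((Fin (p - 1) ⊕ Fin m) ⊕ (Fin a × Fin (2 * p - 1))) ⊕ Fin q → Option (Option (Fin a))
  | .inl (.inl _) => none
  | .inl (.inr x) => some (some x.1)
  | .inr _ => some none

theorem extremalPart_eq_of_adj {m p a q : ℕ}
    {v w : ((Fin (p - 1) ⊕ Fin m) ⊕ (Fin a × Fin (2 * p - 1))) ⊕ Fin q}
    (h : (extremalGraph m p a q).Adj v w) : extremalPart v = extremalPart w := by
  rcases v with (v | v) | v <;> rcases w with (w | w) | w <;>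
    simp_all [extremalPart, copies]

/-- The vertices of `K_{p-1}` in the part `K_{p-1} ∨ I_m` of `extremalGraph`. -/
def extremalCover (m p a q : ℕ) :
    Finset (((Fin (p - 1) ⊕ Fin m) ⊕ (Fin a × Fin (2 * p - 1))) ⊕ Fin q) :=
  univ.map ⟨fun x => .inl (.inl (.inl x)), fun x y h => by simpa using h⟩

theorem mem_extremalCover {m p a q : ℕ}
    {v : ((Fin (p - 1) ⊕ Fin m) ⊕ (Fin a × Fin (2 * p - 1))) ⊕ Fin q} :
    v ∈ extremalCover m p a q ↔ ∃ x, Sum.inl (Sum.inl (Sum.inl x)) = v := by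
  simp only [extremalCover, mem_map, mem_univ, true_and]
  rfl

theorem mem_extremalCover_of_adj {m p a q : ℕ}
    {v w : ((Fin (p - 1) ⊕ Fin m) ⊕ (Fin a × Fin (2 * p - 1))) ⊕ Fin q}
    (h : (extremalGraph m p a q).Adj v w) (hv : extremalPart v = none) :
    v ∈ extremalCover m p a q ∨ w ∈ extremalCover m p a q := by
  rcases v with ((v | v) | v) | v <;> rcases w with ((w | w) | w) | w <;>
    simp_all [extremalPart, mem_extremalCover, join]

theorem card_extremalCover (m p a q : ℕ) : #(extremalCover m p a q) = p - 1 := by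
  simp [extremalCover]

theorem card_extremalPart_some_le {m p a q : ℕ} (i : Fin a) :
    #{v : ((Fin (p - 1) ⊕ Fin m) ⊕ (Fin a × Fin (2 * p - 1))) ⊕ Fin q |
      extremalPart v = some (some i)} ≤ 2 * p - 1 := by
  classical
  calc _ ≤ #(univ.image fun y : Fin (2 * p - 1) => (Sum.inl (Sum.inr (i, y)) :
          ((Fin (p - 1) ⊕ Fin m) ⊕ (Fin a × Fin (2 * p - 1))) ⊕ Fin q)) := card_le_card ?_
    _ ≤ _ := card_image_le.trans_eq (by simp)
  intro v hv
  replace hv := (mem_filter.1 hv).2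
  rcases v with (v | ⟨j, v⟩) | v <;> simp_all [extremalPart]

theorem card_extremalPart_none_le {m p a q : ℕ} :
    #{v : ((Fin (p - 1) ⊕ Fin m) ⊕ (Fin a × Fin (2 * p - 1))) ⊕ Fin q |
      extremalPart v = some none} ≤ q := by
  classical
  calc _ ≤ #(univ.image fun y : Fin q => (Sum.inr y :
          ((Fin (p - 1) ⊕ Fin m) ⊕ (Fin a × Fin (2 * p - 1))) ⊕ Fin q)) := card_le_card ?_
    _ ≤ _ := card_image_le.trans_eq (by simp)
  intro v hv
  replace hv := (mem_filter.1 hv).2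
  rcases v with (v | ⟨j, v⟩) | v <;> simp_all [extremalPart]

/-- The blocks `g (i, ·)` are disjoint, so `S` needs a separate point for each block it meets. -/
theorem card_le_of_meets {ι κ V : Type} {g : ι × κ → V} (hg : Function.Injective g) {T : Finset ι}
    {S : Finset V} (h : ∀ i ∈ T, ∃ j, g (i, j) ∈ S) : #T ≤ #S := by
  classical
  by_cases hκ : Nonempty κ
  · choose! c hc using h
    refine card_le_card_of_injOn (fun i => g (i, c i)) (fun i hi => hc i hi) ?_
    intro i _ j _ hij
    exact (Prod.ext_iff.1 (hg hij)).1
  · obtain rfl : T = ∅ := eq_empty_of_forall_notMem fun i hi => hκ ⟨(h i hi).choose⟩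
    simp

/-- A path stays in one component. The cliques have fewer than `2p` vertices; in the join, the `p`
disjoint edges at positions `2i, 2i+1` would each need one of the `p - 1` cover vertices. -/
theorem P_free_extremalGraph {m p a q : ℕ} (hp : 1 ≤ p) (hq : q < 2 * p) :
    (P (2 * p)).Free (extremalGraph m p a q) := by
  classical
  rintro ⟨f⟩
  have hadj : ∀ i (hi : i + 1 < 2 * p),
      (extremalGraph m p a q).Adj (f ⟨i, by omega⟩) (f ⟨i + 1, hi⟩) := fun i hi =>
    f.toHom.map_adj (pathGraph_adj.2 (.inl rfl))
  have hpart : ∀ i (hi : i < 2 * p), extremalPart (f ⟨i, hi⟩) = extremalPart (f ⟨0, by omega⟩) := by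
    intro i
    induction i with
    | zero => exact fun _ => rfl
    | succ i ih => exact fun hi => (extremalPart_eq_of_adj (hadj i hi)).symm.trans (ih (by omega))
  have hcount : ∀ c, extremalPart (f ⟨0, by omega⟩) = c →
      2 * p ≤ #{v : ((Fin (p - 1) ⊕ Fin m) ⊕ (Fin a × Fin (2 * p - 1))) ⊕ Fin q |
        extremalPart v = c} := by
    intro c hc
    have := card_le_card_of_injOn (s := (univ : Finset (Fin (2 * p))))
      (t := univ.filter fun v => extremalPart v = c) f
      (fun i _ => by simpa using (hpart i.1 i.2).trans hc) (f.injective.injOn)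
    simpa using this
  rcases hc : extremalPart (f ⟨0, by omega⟩) with _ | _ | i
  · let g : Fin p × Fin 2 → _ := fun i => f ⟨2 * i.1 + i.2, by omega⟩
    have hg : Function.Injective g := by
      rintro ⟨i, i'⟩ ⟨j, j'⟩ hij
      have := congrArg Fin.val (f.injective hij)
      simp only at this
      ext <;> simp <;> omega
    have := card_le_of_meets hg (T := univ) (S := extremalCover m p a q) fun i _ => by
      rcases mem_extremalCover_of_adj (hadj (2 * i) (by omega))
        ((hpart _ (by omega)).trans hc) with h | h
      · exact ⟨0, h⟩
      · exact ⟨1, h⟩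
    rw [card_univ, Fintype.card_fin, card_extremalCover] at this
    omega
  · have := (hcount _ hc).trans card_extremalPart_none_le
    omega
  · have := (hcount _ hc).trans (card_extremalPart_some_le i)
    omega

/-- The summands bound the matching edges by component: `p - 1` in the join by its cover, `p - 1` in
each `K_{2p-1}` and `b` in `K_q` by halving the number of vertices. -/
theorem M_free_extremalGraph {m p a b q : ℕ} (hq : q ≤ 2 * b + 1) :
    (M ((p - 1) + a * (p - 1) + b + 1)).Free (extremalGraph m p a q) := by
  classical
  rintro ⟨f⟩
  have hadj : ∀ i, (extremalGraph m p a q).Adj (f (i, 0)) (f (i, 1)) := fun i =>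
    f.toHom.map_adj (show (M _).Adj (i, 0) (i, 1) from ⟨rfl, by simp⟩)
  have hpart : ∀ i j, extremalPart (f (i, j)) = extremalPart (f (i, 0)) := by
    intro i j
    fin_cases j
    · rfl
    · exact (extremalPart_eq_of_adj (hadj i)).symm
  let T : Option (Option (Fin a)) → Finset _ := fun c =>
    univ.filter fun i => extremalPart (f (i, 0)) = c
  have hcount : ∀ c, #(T c) * 2 ≤
      #{v : ((Fin (p - 1) ⊕ Fin m) ⊕ (Fin a × Fin (2 * p - 1))) ⊕ Fin q |
        extremalPart v = c} := by
    intro c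
    have := card_le_card_of_injOn (s := T c ×ˢ (univ : Finset (Fin 2)))
      (t := univ.filter fun v => extremalPart v = c) f
      (fun i hi => by
        have := (mem_filter.1 (mem_product.1 (mem_coe.1 hi)).1).2
        simpa using (hpart i.1 i.2).trans this) (f.injective.injOn)
    simpa using this
  have h0 : #(T none) ≤ p - 1 := by
    refine (card_le_of_meets f.injective fun i hi => ?_).trans_eq (card_extremalCover m p a q)
    rcases mem_extremalCover_of_adj (hadj i) (mem_filter.1 hi).2 with h | h
    · exact ⟨0, h⟩
    · exact ⟨1, h⟩
  have h1 : #(T (some none)) ≤ b := by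
    have := (hcount _).trans card_extremalPart_none_le
    omega
  have h2 : ∀ i, #(T (some (some i))) ≤ p - 1 := fun i => by
    have := (hcount _).trans (card_extremalPart_some_le i)
    omega
  have h3 := card_eq_sum_card_fiberwise (s := univ) (t := univ)
    (f := fun i => extremalPart (f (i, 0))) fun _ _ => mem_coe.2 (mem_univ _)
  rw [card_univ, Fintype.card_fin, Fintype.sum_option, Fintype.sum_option] at h3
  have h4 : ∑ i, #(T (some (some i))) ≤ a * (p - 1) :=
    (sum_le_sum fun i _ => h2 i).trans_eq (by simp)
  change _ = #(T none) + (#(T (some none)) + ∑ i, #(T (some (some i)))) at h3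
  omega

/-- A family-free graph with `n` vertices bounds the generalized Turán number from below. -/
theorem N_K_le_ex {V : Type} [Fintype V] {G : SimpleGraph V} {n : ℕ} (hn : Fintype.card V = n)
    (r : ℕ) {𝓕 : Set (Σ W : Type, SimpleGraph W)} (hG : FamilyFree 𝓕 G) :
    N (K r) G ≤ ex n (K r) 𝓕 := by
  classical
  let e : G ≃g G.map (Fintype.equivFinOfCardEq hn).toEmbedding :=
    Iso.map (Fintype.equivFinOfCardEq hn) G
  refine (N_K_le_of_embedding e.toEmbedding r).trans ?_
  refine le_sup (f := fun G => N (K r) G) (mem_filter.2 ⟨mem_univ _, fun F hF => ?_⟩)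
  exact (free_congr_right e).1 (hG F hF)

theorem familyFree_pair {V : Type} {G : SimpleGraph V} {k l : ℕ} :
    FamilyFree {⟨Fin k, P k⟩, ⟨Fin l × Fin 2, M l⟩} G ↔ (P k).Free G ∧ (M l).Free G := by
  simp [FamilyFree]

theorem le_N_K_G₁ (n p a r : ℕ) :
    (p - 1).choose (r + 1) + (p - 1).choose r * (n - (p - 1) - a * (2 * p - 1)) +
      a * (2 * p - 1).choose (r + 1) ≤ N (K (r + 1)) (G₁ n p a) := by
  have h1 := le_N_K_join r (p - 1) (n - (p - 1) - a * (2 * p - 1))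
  have h2 := mul_N_K_le_N_K_copies a (K (2 * p - 1)) r
  rw [N_K_K] at h2
  exact (add_le_add h1 h2).trans (N_K_add_le_N_K_sum _ _ r)

theorem le_N_K_G₂ (n p a b r : ℕ) :
    (p - 1).choose (r + 1) + (p - 1).choose r * (n - (p - 1) - a * (2 * p - 1) - (2 * b + 1)) +
      a * (2 * p - 1).choose (r + 1) + (2 * b + 1).choose (r + 1) ≤
      N (K (r + 1)) (G₂ n p a b) := by
  have h1 := le_N_K_join r (p - 1) (n - (p - 1) - a * (2 * p - 1) - (2 * b + 1))
  have h2 := mul_N_K_le_N_K_copies a (K (2 * p - 1)) r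
  rw [N_K_K] at h2
  have h3 := (add_le_add h1 h2).trans (N_K_add_le_N_K_sum _ _ r)
  exact (add_le_add h3 (N_K_K _ _).ge).trans (N_K_add_le_N_K_sum _ _ r)

theorem familyFree_G₁ (n : ℕ) {p a b : ℕ} (hp : 1 ≤ p) :
    FamilyFree {⟨Fin (2 * p), P (2 * p)⟩,
      ⟨Fin ((p - 1) + a * (p - 1) + b + 1) × Fin 2, M ((p - 1) + a * (p - 1) + b + 1)⟩}
      (G₁ n p a) := by
  have h : G₁ n p a ⊑ extremalGraph (n - (p - 1) - a * (2 * p - 1)) p a 0 :=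
    (Embedding.sumInl : G₁ n p a ↪g G₁ n p a ⊕g K 0).isContained
  exact familyFree_pair.2 ⟨fun h' => P_free_extremalGraph hp (by omega) (h'.trans h),
    fun h' => M_free_extremalGraph (Nat.zero_le _) (h'.trans h)⟩

theorem familyFree_G₂ (n : ℕ) {p a b : ℕ} (hb : b < p) :
    FamilyFree {⟨Fin (2 * p), P (2 * p)⟩,
      ⟨Fin ((p - 1) + a * (p - 1) + b + 1) × Fin 2, M ((p - 1) + a * (p - 1) + b + 1)⟩}
      (G₂ n p a b) :=
  familyFree_pair.2 ⟨P_free_extremalGraph (by omega) (by omega), M_free_extremalGraph le_rfl⟩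

/-! ### The generalized Turán number -/

theorem N_K_eq_zero_of_P_free {V : Type} [Fintype V] {G : SimpleGraph V} {k r : ℕ}
    (hG : (P k).Free G) (hkr : k ≤ r) : N (K r) G = 0 := by
  rw [N, copyCount_eq_zero]
  intro h
  refine hG (IsContained.trans ?_ h)
  exact ⟨⟨⟨Fin.castLE hkr, fun {x y} hxy hne => hxy.ne (Fin.castLE_injective hkr hne)⟩,
    Fin.castLE_injective hkr⟩⟩

theorem N_K_le_of_familyFree {V : Type} [Fintype V] {G : SimpleGraph V} {p r s : ℕ}
    (hp : 2 ≤ p) (hrp : r + 1 ≤ p) (hP : (P (2 * p)).Free G) (hM : (M (s + 1)).Free G)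
    (hn : 2 ^ (2 * s + 2 ^ (2 * s) * p) + (p - 1).choose r * (p - 1) ≤ Fintype.card V) :
    (N (K (r + 1)) G : ℤ) ≤ (p - 1).choose r * (Fintype.card V - (p - 1 : ℕ)) +
      (p - 1).choose (r + 1) + gainBound p r (s - (p - 1)) := by
  classical
  rw [N_K_eq_card_cliquesIn]
  have hΦ := gainBound_nonneg p r (s - (p - 1))
  -- Counting vertices needs no structure, and the strict binomial inequality of the sparse case
  -- fails for `r = 0`.
  obtain rfl | hr := Nat.eq_zero_or_pos r
  · have := card_cliquesIn_le_choose G (0 + 1) univ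
    rw [zero_add, Nat.choose_one_right, card_univ] at this
    zify at this
    simp only [zero_add, Nat.choose_zero_right, Nat.choose_one_right, Nat.cast_one, one_mul]
    linarith
  · have hs : ∀ B k, MatchedBy G B k → k ≤ s := by
      intro B k hk
      by_contra! h
      obtain ⟨C, -, hC⟩ := hk.exists_of_le (Nat.succ_le_of_lt h)
      obtain ⟨f, -⟩ := hC.exists_copy
      exact hM ⟨f⟩
    rcases exists_star_or_card_cliquesIn_le hp hr hrp hs hn with ⟨S, Y, hS, hY, hdis, hadj⟩ | h
    · exact card_cliquesIn_le_of_star hp hP hs (gainBound_nonneg p r)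
        (fun t k _ hk hkt => gainBound_step hp hrp t k hk hkt) hS hY hdis hadj
    · refine h.trans ?_
      have : (0 : ℤ) ≤ (p - 1).choose (r + 1) := Nat.cast_nonneg _
      linarith

theorem ex_K_P_M_eq_max (r p s a b : ℕ) (hr1 : 1 ≤ r) (hr : r ≤ p ∨ 2 * p ≤ r)
    (hab : (s : ℤ) - p + 1 = a * ((p : ℤ) - 1) + b) (hb : (b : ℤ) ≤ (p : ℤ) - 2) :
    ∃ n₀ : ℕ, ∀ n : ℕ, n₀ ≤ n →
      ex n (K r) {⟨Fin (2 * p), P (2 * p)⟩, ⟨Fin (s + 1) × Fin 2, M (s + 1)⟩} =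
        max (N (K r) (G₁ n p a)) (N (K r) (G₂ n p a b)) := by
  classical
  obtain ⟨r, rfl⟩ := Nat.exists_eq_add_of_le' hr1
  have hp : 2 ≤ p := by omega
  have hbp : b < p - 1 := by omega
  obtain rfl : s = (p - 1) + a * (p - 1) + b := by
    zify [show 1 ≤ p by omega]
    linarith
  generalize hs : (p - 1) + a * (p - 1) + b = s
  -- The first two summands serve the upper bound; the others make all truncated subtractions in the
  -- sizes of `G₁` and `G₂` exact.
  refine ⟨2 ^ (2 * s + 2 ^ (2 * s) * p) + (p - 1).choose r * (p - 1) +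
    ((p - 1) + a * (2 * p - 1) + (2 * b + 1)), fun n hn => ?_⟩
  have hn₁ := (Nat.le_add_right _ _).trans hn
  replace hn := (Nat.le_add_left _ _).trans hn
  refine le_antisymm ?_ (max_le ?_ ?_)
  · refine Finset.sup_le fun G hG => ?_
    obtain ⟨hP, hM⟩ := familyFree_pair.1 (Finset.mem_filter.1 hG).2
    rcases hr with hr | hr
    · have h := N_K_le_of_familyFree hp hr hP hM (by rwa [Fintype.card_fin])
      rw [show s - (p - 1) = a * (p - 1) + b by omega, gainBound_mul_add hr hbp,
        Fintype.card_fin] at h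
      have h1 := le_N_K_G₁ n p a r
      have h2 := le_N_K_G₂ n p a b r
      obtain ⟨m, hm⟩ := Nat.exists_eq_add_of_le hn
      have e1 : n - (p - 1) - a * (2 * p - 1) = m + (2 * b + 1) := by omega
      have e2 : n - (p - 1) - a * (2 * p - 1) - (2 * b + 1) = m := by omega
      replace h1 := (congrArg (fun k => (p - 1).choose (r + 1) + (p - 1).choose r * k +
        a * (2 * p - 1).choose (r + 1)) e1).ge.trans h1
      replace h2 := (congrArg (fun k => (p - 1).choose (r + 1) + (p - 1).choose r * k +
        a * (2 * p - 1).choose (r + 1) + (2 * b + 1).choose (r + 1)) e2).ge.trans h2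
      have hm' : (n : ℤ) - (p - 1 : ℕ) = a * (2 * p - 1 : ℕ) + (2 * b + 1 : ℕ) + m := by
        rw [hm]
        push_cast
        ring
      rw [hm'] at h
      rw [le_max_iff]
      -- If `K_{2b+1}` has no positive gain, its vertices do better in the independent set, as in
      -- `G₁`; otherwise `G₂` reaches the bound.
      rcases max_cases (0 : ℤ)
        ((2 * b + 1).choose (r + 1) - (p - 1).choose r * (2 * b + 1 : ℕ)) with ⟨h3, -⟩ | ⟨h3, -⟩
      · left
        rw [h3] at h
        zify at h1 ⊢
        push_cast at h h1 ⊢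
        linarith
      · right
        rw [h3] at h
        zify at h2 ⊢
        push_cast at h h2 ⊢
        linarith
    · rw [N_K_eq_zero_of_P_free hP hr]
      exact Nat.zero_le _
  · refine N_K_le_ex ?_ _ (hs ▸ familyFree_G₁ n (by omega))
    simp only [Fintype.card_sum, Fintype.card_prod, Fintype.card_fin]
    omega
  · refine N_K_le_ex ?_ _ (hs ▸ familyFree_G₂ n (by omega))
    simp only [Fintype.card_sum, Fintype.card_prod, Fintype.card_fin]
    omega

end GenTuran

theorem theorem1p7 (r p s a b : ℕ) (hr1 : 1 ≤ r) (hr : r ≤ p ∨ 2 * p ≤ r)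
    (hab : (s : ℤ) - p + 1 = a * ((p : ℤ) - 1) + b) (hb : (b : ℤ) ≤ (p : ℤ) - 2) :
    ∃ n₀ : ℕ, ∀ n : ℕ, n₀ ≤ n →
      GenTuran.ex n (GenTuran.K r)
          {⟨Fin (2 * p), GenTuran.P (2 * p)⟩, ⟨Fin (s + 1) × Fin 2, GenTuran.M (s + 1)⟩} =
        max (GenTuran.N (GenTuran.K r) (GenTuran.G₁ n p a))
          (GenTuran.N (GenTuran.K r) (GenTuran.G₂ n p a b)) :=
  GenTuran.ex_K_P_M_eq_max r p s a b hr1 hr hab hb
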